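/- For integers $0\le i\le n$ let ${n \brack i}$ be the unsigned Stirling numbers of the first kind, given by ${n+1 \brack i} = {n \brack i-1} + n{n \brack i}$ and ${0 \brack n}={n \brack 0}=\delta_{n,0}$. For $k\ge 1$ the series $b_k=\sum_{n=1}^\infty \frac{e^{-\pi n^2}}{(\pi n^2)^k}$ converges. Let $$\xi(s) = -\frac{s(1-s)}{2}\,\pi^{-s/2}\,\Gamma\!\left(\tfrac{s}{2}\right)\zeta(s)$$ be the Riemann xi function, with its removable singularities at $s=1,0,-2,-4,\dots$ filled in by limits; it is an entire function. (a) For every $s\in\mathbb{C}$, $$2\xi(s) = 1 - 2\sum_{n=0}^\infty \frac{1}{(n+1)!}\sum_{i=0}^{n} b_{i+1}{n \brack i}\left(s\prod_{j=0}^{i}\Big(\frac{1-s}{2}-j\Big)+(1-s)\prod_{j=0}^{i}\Big(\frac{s}{2}-j\Big)\right),$$ where the series over $n$ converges absolutely. In particular, for $s\notin\{1,0,-2,-4,\dots\}$ its right-hand side equals $-s(1-s)\pi^{-s/2}\Gamma(s/2)\zeta(s)$. (b) For every $s\in\mathbb{C}\setminus\{0,1\}$, $$\pi^{-s/2}\,\Gamma\!\left(\tfrac{s}{2}\right)\zeta(s)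 = 2b_1+\sum_{n=1}^\infty \frac{1}{(n+1)!}\sum_{i=1}^{n} b_{i+1}{n \brack i}\left(\prod_{j=1}^{i}\Big(\frac{1-s}{2}-j\Big)+\prod_{j=1}^{i}\Big(\frac{s}{2}-j\Big)\right)-\Big(\frac{1}{1-s}+\frac1s\Big),$$ where at $s=-2,-4,\dots$ the left-hand side means its limit; the series over $n$ converges absolutely for every $s\in\mathbb{C}$. -/

import Mathlib

open Filter Topology

/-- `π^{-s/2} Γ(s/2) ζ(s)`, literally. It is meaningful where no factor has a pole,
that is for `s ≠ 1` and `s ∉ {0, -2, -4, …}`. -/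
noncomputable def piGammaZeta (s : ℂ) : ℂ :=
  (Real.pi : ℂ) ^ (-s / 2) * Complex.Gamma (s / 2) * riemannZeta s

/-- The points where no factor of `π^{-s/2} Γ(s/2) ζ(s)` has a pole. -/
def IsRegularPoint (s : ℂ) : Prop :=
  s ≠ 1 ∧ ∀ k : ℕ, s ≠ -2 * (k : ℂ)

/-- The Riemann xi function `ξ(s) = -(s(1-s)/2) π^{-s/2} Γ(s/2) ζ(s)`, where the removable
singularities at `1, 0, -2, -4, …` are filled in by taking the limit. -/
noncomputable def riemannXi (s : ℂ) : ℂ :=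
  limUnder (𝓝[≠] s) (fun z : ℂ => -(z * (1 - z) / 2) * piGammaZeta z)

/-- The `n`-th term, counted from `n = 0`, of the series `b_k = ∑_{n ≥ 1} e^{-πn²} / (πn²)^k`. -/
noncomputable def bTerm (k n : ℕ) : ℝ :=
  Real.exp (-(Real.pi * ((n : ℝ) + 1) ^ 2)) / (Real.pi * ((n : ℝ) + 1) ^ 2) ^ k

/-- `b_k = ∑_{n ≥ 1} e^{-πn²} / (πn²)^k`. -/
noncomputable def bConst (k : ℕ) : ℝ :=
  ∑' n : ℕ, bTerm k n

/-- `1/(n+1)! ∑_{i=1}^n b_{i+1} [n,i] (∏_{j=1}^i ((1-s)/2 - j) + ∏_{j=1}^i (s/2 - j))`. -/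
noncomputable def zetaTerm (s : ℂ) (n : ℕ) : ℂ :=
  1 / ((n + 1).factorial : ℂ) * ∑ i ∈ Finset.Icc 1 n,
    (bConst (i + 1) : ℂ) * (Nat.stirlingFirst n i : ℂ) *
      ((∏ j ∈ Finset.Icc 1 i, ((1 - s) / 2 - (j : ℂ))) +
        ∏ j ∈ Finset.Icc 1 i, (s / 2 - (j : ℂ)))

/-- `1/(n+1)! ∑_{i=0}^n b_{i+1} [n,i] (s ∏_{j=0}^i ((1-s)/2 - j) + (1-s) ∏_{j=0}^i (s/2 - j))`. -/
noncomputable def xiTerm (s : ℂ) (n : ℕ) : ℂ :=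
  1 / ((n + 1).factorial : ℂ) * ∑ i ∈ Finset.range (n + 1),
    (bConst (i + 1) : ℂ) * (Nat.stirlingFirst n i : ℂ) *
      (s * (∏ j ∈ Finset.range (i + 1), ((1 - s) / 2 - (j : ℂ))) +
        (1 - s) * ∏ j ∈ Finset.range (i + 1), (s / 2 - (j : ℂ)))

/-!
The Taylor coefficients of `(1 - log (1 - u) / c) ^ z` at `u = 0` are polynomials in `z` and `1 / c`
whose coefficients are Stirling numbers. Substituting `x = 1 - log (1 - u) / c` turns
`∫ x in (1, ∞), x ^ z e^{-cx}` into `e^{-c} / c` times the integral of that function over `(0, 1)`,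
hence formally into the series obtained by integrating it term by term.

Convergence is the issue. For `Re z < 0`, put `z = -a`: multiplying by `Γ(a)` replaces the
coefficients by the Gamma integral of those of `(1 - u) ^ (t / c)`, whose absolute sum is at most
`2 ^ (t / c + 1)`. Against the weight `e^{-t}` this is integrable exactly when `c > log 2`.
Differentiation in `u` relates the coefficients for `z` and `z - 1`, and integration by parts
relates the integrals in the same way, so the result spreads to all `z`.

Splitting the Mellin transform of the theta function at `x = 1` writes the completed zeta function
as a sum of such integrals with `c = π m²`, and `π > log 2`. The bound on the series is uniform in
`c`, so the sums over `m` and `n` may be interchanged, which produces the constants `b_k`.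
-/

open Finset MeasureTheory

section Binomial

theorem sum_range_succ_multichoose {R : Type*} [CommRing R] [BinomialRing R] (r : R) (n : ℕ) :
    ∑ k ∈ range (n + 1), Ring.multichoose r k = Ring.multichoose (r + 1) n := by
  induction n with
  | zero => simp
  | succ n ih => rw [sum_range_succ, ih, Ring.multichoose_succ_succ, add_comm]

theorem ascPochhammer_eval_eq_sum_stirlingFirst {R : Type*} [CommSemiring R] (r : R) (n : ℕ) :
    (ascPochhammer R n).eval r = ∑ i ∈ range (n + 1), (Nat.stirlingFirst n i : R) * r ^ i := by
  induction n with
  | zero => simp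
  | succ n ih =>
    have hshift : (n : R) * ∑ i ∈ range (n + 1), (Nat.stirlingFirst n (i + 1) : R) * r ^ (i + 1) =
        n * ∑ i ∈ range (n + 1), (Nat.stirlingFirst n i : R) * r ^ i := by
      cases n with
      | zero => simp
      | succ n =>
        rw [sum_range_succ, Nat.stirlingFirst_eq_zero_of_lt (n + 1).lt_succ_self,
          sum_range_succ' _ (n + 1), Nat.stirlingFirst_succ_zero]
        simp
    rw [ascPochhammer_succ_eval, ih, sum_range_succ' _ (n + 1), Nat.stirlingFirst_succ_zero]
    simp only [Nat.stirlingFirst_succ_succ, Nat.cast_add, Nat.cast_mul, add_mul, sum_add_distrib,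
      mul_assoc]
    rw [← mul_sum, hshift]
    simp only [mul_add, pow_succ, ← mul_assoc, ← sum_mul, Nat.cast_zero, zero_mul, add_zero]
    ring

theorem factorial_mul_multichoose {R : Type*} [CommRing R] [BinomialRing R] (r : R) (n : ℕ) :
    (n.factorial : R) * Ring.multichoose r n = (ascPochhammer R n).eval r := by
  rw [← nsmul_eq_mul, Ring.factorial_nsmul_multichoose_eq_ascPochhammer,
    Polynomial.ascPochhammer_smeval_eq_eval]

theorem succ_mul_multichoose_succ {R : Type*} [CommRing R] [BinomialRing R] (r : R) (n : ℕ) :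
    (n + 1) * Ring.multichoose r (n + 1) = r * Ring.multichoose (r + 1) n := by
  have h := factorial_mul_multichoose r (n + 1)
  rw [ascPochhammer_succ_left, Polynomial.eval_mul, Polynomial.eval_X, Polynomial.eval_comp,
    Polynomial.eval_add, Polynomial.eval_X, Polynomial.eval_one, ← factorial_mul_multichoose,
    Nat.factorial_succ] at h
  push_cast at h
  have : IsAddTorsionFree R := BinomialRing.toIsAddTorsionFree
  refine nsmul_right_injective n.factorial_ne_zero ?_
  simp only [nsmul_eq_mul]
  linear_combination h

theorem multichoose_nonneg {r : ℝ} (hr : 0 ≤ r) (n : ℕ) : 0 ≤ Ring.multichoose r n := by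
  have hn : (0 : ℝ) < n.factorial := mod_cast n.factorial_pos
  rw [← mul_nonneg_iff_of_pos_left hn, factorial_mul_multichoose,
    ascPochhammer_eval_eq_sum_stirlingFirst]
  positivity

theorem sum_abs_multichoose_neg_le_two {r : ℝ} (hr₀ : 0 ≤ r) (hr₁ : r ≤ 1) (N : ℕ) :
    ∑ n ∈ range N, |Ring.multichoose (-r) n| ≤ 2 := by
  have hnonpos (n : ℕ) : Ring.multichoose (-r) (n + 1) ≤ 0 := by
    have h := succ_mul_multichoose_succ (-r) n
    have := multichoose_nonneg (show 0 ≤ -r + 1 by linarith) n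
    have : (0 : ℝ) < n + 1 := by positivity
    nlinarith
  cases N with
  | zero => simp
  | succ N =>
    have hsum := sum_range_succ_multichoose (-r) N
    have hpos := multichoose_nonneg (show 0 ≤ -r + 1 by linarith) N
    rw [sum_range_succ', Ring.multichoose_zero_right] at hsum
    rw [sum_range_succ', Ring.multichoose_zero_right, abs_one]
    simp only [abs_of_nonpos (hnonpos _), sum_neg_distrib]
    linarith

theorem sum_abs_multichoose_sub_one_le (r : ℝ) (N : ℕ) :
    ∑ n ∈ range N, |Ring.multichoose (r - 1) n| ≤
      2 * ∑ n ∈ range N, |Ring.multichoose r n| := by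
  cases N with
  | zero => simp
  | succ N =>
    have hstep (n : ℕ) : |Ring.multichoose (r - 1) (n + 1)| ≤
        |Ring.multichoose r (n + 1)| + |Ring.multichoose r n| := by
      have h := Ring.multichoose_succ_succ (r - 1) n
      rw [sub_add_cancel] at h
      rw [← sub_eq_of_eq_add h]
      exact abs_sub _ _
    have hle := sum_le_sum fun n (_ : n ∈ range N) => hstep n
    rw [sum_add_distrib] at hle
    have hlast := abs_nonneg (Ring.multichoose r N)
    rw [two_mul]
    nth_rw 2 [sum_range_succ]
    rw [sum_range_succ', sum_range_succ']
    simp only [Ring.multichoose_zero_right] at hle ⊢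
    linarith

theorem sum_abs_multichoose_neg_le {r : ℝ} (hr : 0 ≤ r) (N : ℕ) :
    ∑ n ∈ range N, |Ring.multichoose (-r) n| ≤ 2 ^ (r + 1) := by
  have hnat (m : ℕ) : ∀ r : ℝ, 0 ≤ r → r ≤ m + 1 →
      ∑ n ∈ range N, |Ring.multichoose (-r) n| ≤ 2 ^ (m + 1) := by
    induction m with
    | zero =>
      intro r hr hr1
      simpa using sum_abs_multichoose_neg_le_two hr (by simpa using hr1) N
    | succ m ih =>
      intro r hr hrm
      rcases le_total r 1 with hr1 | hr1
      · exact (sum_abs_multichoose_neg_le_two hr hr1 N).trans (le_self_pow₀ one_le_two (by simp))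
      · have h := sum_abs_multichoose_sub_one_le (-(r - 1)) N
        rw [show -(r - 1) - 1 = -r by ring] at h
        rw [pow_succ']
        push_cast at hrm
        linarith [ih (r - 1) (by linarith) (by linarith)]
  refine (hnat ⌊r⌋₊ r hr (Nat.lt_floor_add_one r).le).trans ?_
  rw [← Real.rpow_natCast]
  push_cast
  gcongr
  · norm_num
  · exact Nat.floor_le hr

theorem summable_multichoose_neg {r : ℝ} (hr : 0 ≤ r) :
    Summable fun n => |Ring.multichoose (-r) n| :=
  summable_of_sum_range_le (fun _ => abs_nonneg _) (sum_abs_multichoose_neg_le hr)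

theorem hasSum_multichoose_neg_div {r : ℝ} (hr : 0 ≤ r) :
    HasSum (fun n : ℕ => Ring.multichoose (-r) n / (n + 1)) (1 / (r + 1)) := by
  have hr1 : r + 1 ≠ 0 := by positivity
  have hpartial (N : ℕ) : ∑ n ∈ range N, Ring.multichoose (-r) n / ((n : ℝ) + 1) =
      (1 - Ring.multichoose (-r) N) / (r + 1) := by
    have h := sum_range_succ_multichoose (-r - 1) N
    rw [sum_range_succ', Ring.multichoose_zero_right, sub_add_cancel] at h
    rw [eq_div_iff hr1, ← h, sum_mul]
    rw [sub_add_cancel_right, ← sum_neg_distrib]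
    refine sum_congr rfl fun n _ => ?_
    have h := succ_mul_multichoose_succ (-r - 1) n
    rw [sub_add_cancel] at h
    have : (n : ℝ) + 1 ≠ 0 := by positivity
    field_simp
    linear_combination h
  have hsummable : Summable fun n : ℕ => Ring.multichoose (-r) n / ((n : ℝ) + 1) := by
    refine (summable_multichoose_neg hr).of_norm_bounded fun n => ?_
    rw [norm_div, Real.norm_eq_abs]
    refine div_le_self (abs_nonneg _) ?_
    rw [Real.norm_of_nonneg (by positivity)]
    simp
  rw [hsummable.hasSum_iff_tendsto_nat]
  simp only [hpartial]
  have hzero := (summable_multichoose_neg hr).of_abs.tendsto_atTop_zero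
  simpa using (hzero.const_sub 1).div_const (r + 1)

end Binomial

theorem norm_natCast_add_one {𝕜 : Type*} [RCLike 𝕜] (n : ℕ) : ‖(n : 𝕜) + 1‖ = n + 1 := by
  exact_mod_cast RCLike.norm_natCast (K := 𝕜) (n + 1)

section PartialSums

theorem sum_range_partialSum_div_mul {K : Type*} [Field K] [CharZero K] (a : ℕ → K) (N : ℕ) :
    ∑ n ∈ range N, (∑ k ∈ range (n + 1), a k) / ((n + 1) * (n + 2)) =
      ∑ k ∈ range N, a k / (k + 1) - (∑ k ∈ range N, a k) / (N + 1) := by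
  induction N with
  | zero => simp
  | succ N ih =>
    have h1 : (N : K) + 1 ≠ 0 := by exact_mod_cast N.succ_ne_zero
    have h2 : (N : K) + 2 ≠ 0 := by exact_mod_cast (N + 1).succ_ne_zero
    have h3 : (N : K) + 1 + 1 ≠ 0 := by rwa [add_assoc, one_add_one_eq_two]
    rw [sum_range_succ, ih, sum_range_succ (fun k => a k / _), sum_range_succ a]
    push_cast
    field_simp
    ring

theorem tendsto_partialSum_div_of_summable {𝕜 : Type*} [RCLike 𝕜] {a : ℕ → 𝕜}
    (ha : Summable fun k : ℕ => ‖a k‖ / (k + 1)) :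
    Tendsto (fun N : ℕ => (∑ k ∈ range N, a k) / ((N : 𝕜) + 1)) atTop (𝓝 0) := by
  have hterm (k : ℕ) : Tendsto (fun N : ℕ => if k < N then a k / ((N : 𝕜) + 1) else 0)
      atTop (𝓝 0) := by
    have h : Tendsto (fun N : ℕ => a k * (1 / ((N : 𝕜) + 1))) atTop (𝓝 (a k * 0)) :=
      tendsto_one_div_add_atTop_nhds_zero_nat.const_mul _
    rw [mul_zero] at h
    refine h.congr' ?_
    filter_upwards [eventually_gt_atTop k] with N hN
    rw [if_pos hN, mul_one_div]
  have hbound (N k : ℕ) : ‖if k < N then a k / ((N : 𝕜) + 1) else 0‖ ≤ ‖a k‖ / (k + 1) := by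
    split_ifs with hkN
    · rw [norm_div, norm_natCast_add_one]
      gcongr
    · simpa using by positivity
  have h := tendsto_tsum_of_dominated_convergence ha hterm (.of_forall hbound)
  rw [tsum_zero] at h
  refine h.congr fun N => ?_
  rw [sum_div, tsum_eq_sum (s := range N)]
  · exact sum_congr rfl fun k hk => if_pos (mem_range.1 hk)
  · exact fun k hk => if_neg (mem_range.not.1 hk)

end PartialSums

section StirlingCoeff

theorem stirlingFirst_succ_succ_div_factorial {K : Type*} [Field K] [CharZero K] (n i : ℕ) :
    (Nat.stirlingFirst (n + 1) (i + 1) : K) / n.factorial =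
      ∑ k ∈ range (n + 1), (Nat.stirlingFirst k i : K) / k.factorial := by
  induction n with
  | zero => simp [Nat.stirlingFirst_succ_succ]
  | succ n ih =>
    have hn : (n.factorial : K) ≠ 0 := mod_cast n.factorial_ne_zero
    have hn1 : (n : K) + 1 ≠ 0 := mod_cast n.succ_ne_zero
    rw [sum_range_succ, ← ih, Nat.stirlingFirst_succ_succ (n + 1), Nat.factorial_succ]
    push_cast
    field_simp

/-- The `n`-th Taylor coefficient at `u = 0` of `(1 - log (1 - u) / c) ^ z`, expanded by means of
`(-log (1 - u)) ^ i / i! = ∑ n, [n, i] u ^ n / n!`. The Pochhammer polynomial is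
`z (z - 1) ⋯ (z - i + 1)`. -/
noncomputable def stirlingCoeff (c : ℝ) (z : ℂ) (n : ℕ) : ℂ :=
  (∑ i ∈ range (n + 1), (Nat.stirlingFirst n i : ℂ) * ((descPochhammer ℂ i).eval z / c ^ i)) /
    n.factorial

theorem stirlingCoeff_zero (c : ℝ) (z : ℂ) : stirlingCoeff c z 0 = 1 := by
  simp [stirlingCoeff]

theorem succ_mul_stirlingCoeff_succ (c : ℝ) (z : ℂ) (n : ℕ) :
    (n + 1) * stirlingCoeff c z (n + 1) =
      z / c * ∑ k ∈ range (n + 1), stirlingCoeff c (z - 1) k := by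
  have hextend (k : ℕ) (hk : k ∈ range (n + 1)) : stirlingCoeff c (z - 1) k =
      ∑ i ∈ range (n + 1), (Nat.stirlingFirst k i : ℂ) / k.factorial *
        ((descPochhammer ℂ i).eval (z - 1) / c ^ i) := by
    rw [stirlingCoeff, sum_div]
    refine sum_subset_zero_on_sdiff (range_mono (mem_range.1 hk)) (fun i hi => ?_) fun i _ => ?_
    · have hki : k < i := by simpa using (mem_sdiff.1 hi).2
      simp [Nat.stirlingFirst_eq_zero_of_lt hki]
    · ring
  have hsucc (i : ℕ) :
      (descPochhammer ℂ (i + 1)).eval z = z * (descPochhammer ℂ i).eval (z - 1) := by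
    simp [descPochhammer_succ_left, Polynomial.eval_comp]
  have hn : (n.factorial : ℂ) ≠ 0 := mod_cast n.factorial_ne_zero
  have hn1 : (n : ℂ) + 1 ≠ 0 := mod_cast n.succ_ne_zero
  rw [sum_congr rfl hextend, sum_comm]
  simp only [← sum_mul, ← stirlingFirst_succ_succ_div_factorial]
  rw [stirlingCoeff, sum_range_succ', Nat.stirlingFirst_succ_zero, mul_sum, Nat.factorial_succ,
    Nat.cast_zero, zero_mul, add_zero, mul_div_assoc', mul_sum, sum_div]
  refine sum_congr rfl fun i _ => ?_
  rw [hsucc, pow_succ]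
  push_cast
  field_simp

end StirlingCoeff

theorem complex_induction_re {P : ℂ → Prop} (neg : ∀ z : ℂ, z.re < 0 → P z)
    (step : ∀ z, P (z - 1) → P z) (z : ℂ) : P z := by
  have hnat (n : ℕ) : ∀ z : ℂ, z.re < n → P z := by
    induction n with
    | zero => simpa using neg
    | succ n ih =>
      intro z hz
      push_cast at hz
      exact step z (ih _ (by simpa [sub_lt_iff_lt_add] using hz))
  obtain ⟨n, hn⟩ := exists_nat_gt z.re
  exact hnat n z hn

section GenExpIntegral

theorem norm_cpow_mul_exp (z : ℂ) {x : ℝ} (hx : 0 < x) (y : ℝ) :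
    ‖(x : ℂ) ^ z * (Real.exp y : ℂ)‖ = x ^ z.re * Real.exp y := by
  rw [norm_mul, Complex.norm_cpow_eq_rpow_re_of_pos hx, Complex.norm_real,
    Real.norm_of_nonneg (Real.exp_nonneg y)]

theorem integrableOn_cpow_mul_exp_neg_Ioi_zero {z : ℂ} (hz : -1 < z.re) {c : ℝ} (hc : 0 < c) :
    IntegrableOn (fun x : ℝ => (x : ℂ) ^ z * (Real.exp (-(c * x)) : ℂ)) (Set.Ioi 0) := by
  have h := integrableOn_rpow_mul_exp_neg_mul_rpow hz one_pos hc
  refine Integrable.mono' h (by fun_prop) ?_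
  filter_upwards [ae_restrict_mem measurableSet_Ioi] with x hx
  rw [norm_cpow_mul_exp z hx, Real.rpow_one, neg_mul]

theorem integrableOn_cpow_mul_exp_neg_Ioi_one (z : ℂ) {c : ℝ} (hc : 0 < c) :
    IntegrableOn (fun x : ℝ => (x : ℂ) ^ z * (Real.exp (-(c * x)) : ℂ)) (Set.Ioi 1) := by
  have h := integrableOn_rpow_mul_exp_neg_mul_rpow
    (neg_one_lt_zero.trans_le (abs_nonneg z.re)) one_pos hc
  refine Integrable.mono' (h.mono_set (Set.Ioi_subset_Ioi zero_le_one)) (by fun_prop) ?_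
  filter_upwards [ae_restrict_mem measurableSet_Ioi] with x hx
  rw [norm_cpow_mul_exp z (zero_lt_one.trans hx), Real.rpow_one, neg_mul]
  gcongr
  · exact (Set.mem_Ioi.1 hx).le
  · exact le_abs_self _

/-- The generalized exponential integral `E_{-z}(c) = ∫ x in (1, ∞), x ^ z e^{-cx}`. -/
noncomputable def genExpIntegral (c : ℝ) (z : ℂ) : ℂ :=
  ∫ x in Set.Ioi (1 : ℝ), (x : ℂ) ^ z * (Real.exp (-(c * x)) : ℂ)

theorem mul_genExpIntegral {c : ℝ} (hc : 0 < c) (z : ℂ) :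
    c * genExpIntegral c z = Real.exp (-c) + z * genExpIntegral c (z - 1) := by
  have hderiv (x : ℝ) (hx : x ∈ Set.Ici (1 : ℝ)) :
      HasDerivAt (fun x : ℝ => (x : ℂ) ^ z * (Real.exp (-(c * x)) : ℂ))
        (z * ((x : ℂ) ^ (z - 1) * (Real.exp (-(c * x)) : ℂ)) -
          c * ((x : ℂ) ^ z * (Real.exp (-(c * x)) : ℂ))) x := by
    have hpow := (hasDerivAt_id (x : ℂ)).cpow_const (c := z) (.inl (zero_lt_one.trans_le hx))
    have hexp := (((hasDerivAt_id x).const_mul c).neg.exp).ofReal_comp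
    convert! hpow.comp_ofReal.mul hexp using 1
    simp only [Complex.ofReal_exp, Complex.ofReal_neg, Complex.ofReal_mul, id_eq, mul_one,
      Pi.neg_apply, mul_neg]
    ring
  have hint := fun w => integrableOn_cpow_mul_exp_neg_Ioi_one w hc
  have hlim : Tendsto (fun x : ℝ => (x : ℂ) ^ z * (Real.exp (-(c * x)) : ℂ)) atTop (𝓝 0) := by
    rw [tendsto_zero_iff_norm_tendsto_zero]
    refine (tendsto_rpow_mul_exp_neg_mul_atTop_nhds_zero z.re c hc).congr' ?_
    filter_upwards [eventually_gt_atTop 0] with x hx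
    rw [norm_cpow_mul_exp z hx, neg_mul]
  have h := integral_Ioi_of_hasDerivAt_of_tendsto' hderiv
    (((hint (z - 1)).const_mul z).sub ((hint z).const_mul (c : ℂ))) hlim
  rw [integral_sub ((hint (z - 1)).const_mul z) ((hint z).const_mul (c : ℂ)),
    integral_const_mul, integral_const_mul] at h
  simp only [Complex.ofReal_one, Complex.one_cpow, mul_one, one_mul, zero_sub] at h
  rw [genExpIntegral, genExpIntegral]
  linear_combination -h

theorem integral_exp_neg_mul_Ioi_one {y : ℝ} (hy : 0 < y) :
    ∫ x in Set.Ioi (1 : ℝ), (Real.exp (-(y * x)) : ℂ) = Real.exp (-y) / y := by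
  have h := integral_exp_mul_Ioi (neg_lt_zero.2 hy) 1
  simp only [neg_mul, mul_one, neg_div_neg_eq] at h
  rw [integral_complex_ofReal, h, Complex.ofReal_div]

theorem Gamma_mul_cpow_neg {a : ℂ} (ha : 0 < a.re) {x : ℝ} (hx : 0 < x) :
    Complex.Gamma a * (x : ℂ) ^ (-a) =
      ∫ t in Set.Ioi (0 : ℝ), (t : ℂ) ^ (a - 1) * (Real.exp (-(t * x)) : ℂ) := by
  have harg : (x : ℂ).arg ≠ Real.pi := by
    rw [Complex.arg_ofReal_of_nonneg hx.le]
    exact Real.pi_pos.ne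
  have h := Complex.integral_cpow_mul_exp_neg_mul_Ioi ha hx
  rw [one_div, Complex.inv_cpow _ _ harg, ← Complex.cpow_neg] at h
  rw [mul_comm, ← h]
  push_cast
  simp only [mul_comm (x : ℂ)]

theorem integrable_cpow_mul_exp_neg_prod {c : ℝ} (hc : 0 < c) {a : ℂ} (ha : 0 < a.re) :
    Integrable (fun p : ℝ × ℝ => (p.2 : ℂ) ^ (a - 1) * (Real.exp (-((c + p.2) * p.1)) : ℂ))
      ((volume.restrict (Set.Ioi 1)).prod (volume.restrict (Set.Ioi 0))) := by
  have hx := integrableOn_cpow_mul_exp_neg_Ioi_one 0 hc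
  have ht := integrableOn_cpow_mul_exp_neg_Ioi_zero (z := a - 1) (by simpa using ha) one_pos
  refine Integrable.mono (hx.mul_prod ht) (by fun_prop) ?_
  rw [Measure.prod_restrict]
  filter_upwards [ae_restrict_mem (measurableSet_Ioi.prod measurableSet_Ioi)] with p hp
  obtain ⟨hp₁, hp₂⟩ : 1 < p.1 ∧ 0 < p.2 := hp
  rw [norm_mul (_ * _), norm_cpow_mul_exp _ hp₂, norm_cpow_mul_exp _ (zero_lt_one.trans hp₁),
    norm_cpow_mul_exp _ hp₂, Complex.zero_re, Real.rpow_zero, one_mul, mul_left_comm,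
    ← Real.exp_add]
  gcongr
  nlinarith

theorem Gamma_mul_genExpIntegral_neg {c : ℝ} (hc : 0 < c) {a : ℂ} (ha : 0 < a.re) :
    Complex.Gamma a * genExpIntegral c (-a) =
      ∫ t in Set.Ioi (0 : ℝ), (t : ℂ) ^ (a - 1) * (Real.exp (-(c + t)) : ℂ) / (c + t) := by
  calc Complex.Gamma a * genExpIntegral c (-a)
      = ∫ x in Set.Ioi (1 : ℝ), ∫ t in Set.Ioi (0 : ℝ),
          (t : ℂ) ^ (a - 1) * (Real.exp (-((c + t) * x)) : ℂ) := by
        rw [genExpIntegral, ← integral_const_mul]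
        refine setIntegral_congr_fun measurableSet_Ioi fun x hx => ?_
        rw [← mul_assoc, Gamma_mul_cpow_neg ha (zero_lt_one.trans hx), ← integral_mul_const]
        simp only [mul_assoc, ← Complex.ofReal_mul, ← Real.exp_add, add_mul, neg_add_rev]
    _ = ∫ t in Set.Ioi (0 : ℝ), ∫ x in Set.Ioi (1 : ℝ),
          (t : ℂ) ^ (a - 1) * (Real.exp (-((c + t) * x)) : ℂ) :=
        integral_integral_swap (integrable_cpow_mul_exp_neg_prod hc ha)
    _ = ∫ t in Set.Ioi (0 : ℝ), (t : ℂ) ^ (a - 1) * (Real.exp (-(c + t)) : ℂ) / (c + t) := by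
        refine setIntegral_congr_fun measurableSet_Ioi fun t ht => ?_
        rw [integral_const_mul, integral_exp_neg_mul_Ioi_one (add_pos hc ht), mul_div_assoc,
          Complex.ofReal_add]

end GenExpIntegral

section GammaIntegral

/-- The integrand of `Γ(a) c_n(-a) = ∫ t in (0, ∞), t ^ (a - 1) e^{-t} p_n(-t / c)`, where `c_n` is
`stirlingCoeff c` and `p_n(r) = r (r + 1) ⋯ (r + n - 1) / n!`. -/
noncomputable def stirlingKernel (c : ℝ) (a : ℂ) (n : ℕ) (t : ℝ) : ℂ :=
  (t : ℂ) ^ (a - 1) * (Real.exp (-t) : ℂ) * (Ring.multichoose (-(t / c)) n : ℝ)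

theorem Gamma_mul_descPochhammer_eval_neg {a : ℂ} (ha : 0 < a.re) (i : ℕ) :
    Complex.Gamma a * (descPochhammer ℂ i).eval (-a) = (-1) ^ i * Complex.Gamma (a + i) := by
  have hpole (k : ℕ) : a ≠ -k := by
    rintro rfl
    simp only [Complex.neg_re, Complex.natCast_re] at ha
    linarith [(k.cast_nonneg : (0 : ℝ) ≤ k)]
  have hasc := ascPochhammer_eval_neg_eq_descPochhammer ℂ (-a) i
  rw [neg_neg, ← Complex.Gamma_add_nat_div_Gamma_eq a hpole,
    div_eq_iff (Complex.Gamma_ne_zero_of_re_pos ha)] at hasc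
  rw [hasc, ← mul_assoc, ← mul_assoc, ← mul_pow]
  simp [mul_comm]

theorem stirlingKernel_eq_sum {t : ℝ} (ht : 0 < t) (c : ℝ) (a : ℂ) (n : ℕ) :
    stirlingKernel c a n t =
      (∑ i ∈ range (n + 1), (Nat.stirlingFirst n i * (-1 / c) ^ i : ℂ) *
        ((Real.exp (-t) : ℂ) * (t : ℂ) ^ (a + i - 1))) / n.factorial := by
  have hn : (n.factorial : ℝ) ≠ 0 := mod_cast n.factorial_ne_zero
  have hmultichoose : Ring.multichoose (-(t / c)) n =
      (∑ i ∈ range (n + 1), (Nat.stirlingFirst n i : ℝ) * (-(t / c)) ^ i) / n.factorial := by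
    rw [eq_div_iff hn, mul_comm, factorial_mul_multichoose,
      ascPochhammer_eval_eq_sum_stirlingFirst]
  rw [stirlingKernel, hmultichoose]
  push_cast
  rw [mul_div_assoc', mul_sum]
  congr 1
  refine sum_congr rfl fun i _ => ?_
  rw [add_sub_right_comm, Complex.cpow_add _ _ (mod_cast ht.ne'), Complex.cpow_natCast,
    ← neg_div, neg_eq_neg_one_mul (t : ℂ), mul_div_right_comm, mul_pow]
  ring

theorem integrableOn_stirlingKernel (c : ℝ) {a : ℂ} (ha : 0 < a.re) (n : ℕ) :
    IntegrableOn (stirlingKernel c a n) (Set.Ioi 0) := by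
  refine (integrableOn_congr_fun (fun t ht => stirlingKernel_eq_sum ht c a n)
    measurableSet_Ioi).2 ((integrable_finsetSum _ fun i _ => ?_).div_const _)
  refine (Complex.GammaIntegral_convergent ?_).const_mul _
  simpa using by positivity

theorem integral_stirlingKernel (c : ℝ) {a : ℂ} (ha : 0 < a.re) (n : ℕ) :
    ∫ t in Set.Ioi (0 : ℝ), stirlingKernel c a n t =
      Complex.Gamma a * stirlingCoeff c (-a) n := by
  have hre (i : ℕ) : 0 < (a + i).re := by simpa using by positivity
  rw [setIntegral_congr_fun measurableSet_Ioi fun t ht => stirlingKernel_eq_sum ht c a n,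
    integral_div, integral_finsetSum _ fun i _ =>
      (Complex.GammaIntegral_convergent (hre i)).const_mul _, stirlingCoeff, mul_div_assoc',
    mul_sum]
  congr 1
  refine sum_congr rfl fun i _ => ?_
  rw [integral_const_mul, ← Complex.GammaIntegral, ← Complex.Gamma_eq_integral (hre i),
    mul_left_comm, mul_div_assoc', Gamma_mul_descPochhammer_eval_neg ha, div_pow]
  ring

theorem sum_norm_stirlingKernel_le {c₀ c t : ℝ} (hc₀ : 0 < c₀) (hc : c₀ ≤ c) (ht : 0 < t)
    (a : ℂ) (N : ℕ) :
    ∑ n ∈ range N, ‖stirlingKernel c a n t‖ ≤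
      2 * ‖(t : ℂ) ^ (a - 1) * (Real.exp (-((1 - Real.log 2 / c₀) * t)) : ℂ)‖ := by
  have hpos : 0 < c := hc₀.trans_le hc
  have hlog : Real.log 2 * (t / c) ≤ Real.log 2 / c₀ * t := by
    rw [mul_div_assoc', mul_div_right_comm]
    gcongr
  calc ∑ n ∈ range N, ‖stirlingKernel c a n t‖
      = t ^ (a - 1).re * Real.exp (-t) * ∑ n ∈ range N, |Ring.multichoose (-(t / c)) n| := by
        simp only [stirlingKernel, norm_mul _ (Complex.ofReal (Ring.multichoose _ _)),
          Complex.norm_real, Real.norm_eq_abs, ← mul_sum, norm_cpow_mul_exp _ ht]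
    _ ≤ t ^ (a - 1).re * Real.exp (-t) * 2 ^ (t / c + 1) := by
        gcongr
        exact sum_abs_multichoose_neg_le (by positivity) N
    _ = 2 * (t ^ (a - 1).re * Real.exp (-t + Real.log 2 * (t / c))) := by
        rw [Real.rpow_add two_pos, Real.rpow_one, Real.rpow_def_of_pos two_pos, Real.exp_add]
        ring
    _ ≤ 2 * ‖(t : ℂ) ^ (a - 1) * (Real.exp (-((1 - Real.log 2 / c₀) * t)) : ℂ)‖ := by
        rw [norm_cpow_mul_exp _ ht]
        gcongr
        linarith

theorem sum_integral_norm_stirlingKernel_le {c₀ c : ℝ} (hc₀ : Real.log 2 < c₀) (hc : c₀ ≤ c)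
    {a : ℂ} (ha : 0 < a.re) (N : ℕ) :
    ∑ n ∈ range N, ∫ t in Set.Ioi (0 : ℝ), ‖stirlingKernel c a n t‖ ≤
      ∫ t in Set.Ioi (0 : ℝ),
        2 * ‖(t : ℂ) ^ (a - 1) * (Real.exp (-((1 - Real.log 2 / c₀) * t)) : ℂ)‖ := by
  have hpos : 0 < c₀ := (Real.log_pos one_lt_two).trans hc₀
  have hint (n : ℕ) := (integrableOn_stirlingKernel c ha n).norm
  rw [← integral_finsetSum _ fun n _ => hint n]
  refine setIntegral_mono_on (integrable_finsetSum _ fun n _ => hint n) ?_ measurableSet_Ioi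
    fun t ht => sum_norm_stirlingKernel_le hpos hc ht a N
  refine ((integrableOn_cpow_mul_exp_neg_Ioi_zero (by simpa using ha) ?_).norm).const_mul _
  rwa [sub_pos, div_lt_one hpos]

theorem hasSum_stirlingKernel_div {c t : ℝ} (hc : 0 < c) (ht : 0 < t) (a : ℂ) :
    HasSum (fun n : ℕ => stirlingKernel c a n t / (n + 1))
      (c * Real.exp c * ((t : ℂ) ^ (a - 1) * (Real.exp (-(c + t)) : ℂ) / (c + t))) := by
  have h := (Complex.hasSum_ofReal.2 (hasSum_multichoose_neg_div (div_pos ht hc).le)).mul_left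
    ((t : ℂ) ^ (a - 1) * (Real.exp (-t) : ℂ))
  have hc' : (c : ℂ) ≠ 0 := mod_cast hc.ne'
  have hct : (c + t : ℂ) ≠ 0 := mod_cast (add_pos hc ht).ne'
  have htc : (t + c : ℂ) ≠ 0 := by rwa [add_comm]
  convert! h using 1
  · ext n
    rw [stirlingKernel]
    push_cast
    ring
  · have hexp : Real.exp (-t) = Real.exp c * Real.exp (-(c + t)) := by
      rw [← Real.exp_add]
      ring_nf
    rw [hexp]
    push_cast
    field_simp
    ring

end GammaIntegral

section StirlingSeries

theorem exists_sum_norm_stirlingCoeff_neg_le {c₀ : ℝ} (hc₀ : Real.log 2 < c₀) {a : ℂ}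
    (ha : 0 < a.re) :
    ∃ C, ∀ c, c₀ ≤ c → ∀ N, ∑ n ∈ range N, ‖stirlingCoeff c (-a) n‖ / (n + 1) ≤ C := by
  have hgamma : 0 < ‖Complex.Gamma a‖ := norm_pos_iff.2 (Complex.Gamma_ne_zero_of_re_pos ha)
  refine ⟨(∫ t in Set.Ioi (0 : ℝ),
    2 * ‖(t : ℂ) ^ (a - 1) * (Real.exp (-((1 - Real.log 2 / c₀) * t)) : ℂ)‖) / ‖Complex.Gamma a‖,
    fun c hc N => ?_⟩
  rw [le_div_iff₀ hgamma, sum_mul]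
  refine (sum_le_sum fun n _ => ?_).trans (sum_integral_norm_stirlingKernel_le hc₀ hc ha N)
  calc ‖stirlingCoeff c (-a) n‖ / (n + 1) * ‖Complex.Gamma a‖
      ≤ ‖stirlingCoeff c (-a) n‖ * ‖Complex.Gamma a‖ := by
        gcongr
        exact div_le_self (norm_nonneg _) (by simp)
    _ = ‖∫ t in Set.Ioi (0 : ℝ), stirlingKernel c a n t‖ := by
        rw [integral_stirlingKernel c ha, norm_mul, mul_comm]
    _ ≤ ∫ t in Set.Ioi (0 : ℝ), ‖stirlingKernel c a n t‖ := norm_integral_le_integral_norm _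

theorem hasSum_stirlingCoeff_neg_div {c : ℝ} (hc : Real.log 2 < c) {a : ℂ} (ha : 0 < a.re) :
    HasSum (fun n : ℕ => stirlingCoeff c (-a) n / (n + 1))
      (c * Real.exp c * genExpIntegral c (-a)) := by
  have hpos : 0 < c := (Real.log_pos one_lt_two).trans hc
  have hgamma := Complex.Gamma_ne_zero_of_re_pos ha
  have hint (n : ℕ) := integrableOn_stirlingKernel c ha n
  have hsummable : Summable fun n : ℕ =>
      ∫ t in Set.Ioi (0 : ℝ), ‖stirlingKernel c a n t / ((n : ℂ) + 1)‖ := by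
    refine .of_nonneg_of_le (fun n => integral_nonneg fun t => norm_nonneg _) (fun n => ?_)
      (summable_of_sum_range_le (fun n => integral_nonneg fun t => norm_nonneg _)
        (sum_integral_norm_stirlingKernel_le hc le_rfl ha))
    refine integral_mono ((hint n).div_const _).norm (hint n).norm fun t => ?_
    rw [norm_div, norm_natCast_add_one]
    exact div_le_self (norm_nonneg _) (by simp)
  have h := hasSum_integral_of_summable_integral_norm (fun n => (hint n).div_const _) hsummable
  simp only [integral_div, integral_stirlingKernel c ha] at h
  rw [setIntegral_congr_fun measurableSet_Ioi fun t ht =>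
    (hasSum_stirlingKernel_div hpos ht a).tsum_eq, integral_const_mul,
    ← Gamma_mul_genExpIntegral_neg hpos ha, mul_left_comm] at h
  simp only [mul_div_assoc] at h
  exact (hasSum_mul_left_iff hgamma).1 h

theorem sum_norm_stirlingCoeff_le {c : ℝ} (hc : 0 < c) (z : ℂ) (N : ℕ) :
    ∑ n ∈ range (N + 1), ‖stirlingCoeff c z n‖ / (n + 1) ≤
      1 + ‖z‖ / c * ∑ n ∈ range N, ‖stirlingCoeff c (z - 1) n‖ / (n + 1) := by
  have hterm (n : ℕ) : ‖stirlingCoeff c z (n + 1)‖ / ((n + 1 : ℕ) + 1) ≤ ‖z‖ / c *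
      ((∑ k ∈ range (n + 1), ‖stirlingCoeff c (z - 1) k‖) / ((n + 1) * (n + 2))) := by
    have h := congrArg norm (succ_mul_stirlingCoeff_succ c z n)
    rw [norm_mul, norm_mul, norm_div, norm_natCast_add_one, Complex.norm_real,
      Real.norm_of_nonneg hc.le] at h
    rw [mul_div_assoc', div_le_div_iff₀ (by positivity) (by positivity)]
    push_cast
    have := mul_le_mul_of_nonneg_left (norm_sum_le (range (n + 1)) (stirlingCoeff c (z - 1)))
      (show 0 ≤ ‖z‖ / c by positivity)
    nlinarith
  rw [sum_range_succ', stirlingCoeff_zero, add_comm]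
  refine add_le_add (by simp) ((sum_le_sum fun n _ => hterm n).trans ?_)
  rw [← mul_sum, sum_range_partialSum_div_mul]
  gcongr
  exact sub_le_self _ (by positivity)

theorem sum_stirlingCoeff_div (c : ℝ) (z : ℂ) (N : ℕ) :
    ∑ n ∈ range (N + 1), stirlingCoeff c z n / (n + 1) =
      1 + z / c * (∑ n ∈ range N, stirlingCoeff c (z - 1) n / (n + 1) -
        (∑ n ∈ range N, stirlingCoeff c (z - 1) n) / (N + 1)) := by
  rw [sum_range_succ', stirlingCoeff_zero, ← sum_range_partialSum_div_mul, mul_sum, add_comm]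
  congr 1
  · simp
  · refine sum_congr rfl fun n _ => ?_
    have hn : (n : ℂ) + 1 ≠ 0 := mod_cast n.succ_ne_zero
    have h := succ_mul_stirlingCoeff_succ c z n
    rw [mul_div_assoc', ← h, mul_div_mul_left _ _ hn]
    push_cast
    ring

theorem exists_sum_norm_stirlingCoeff_le {c₀ : ℝ} (hc₀ : Real.log 2 < c₀) (z : ℂ) :
    ∃ C, ∀ c, c₀ ≤ c → ∀ N, ∑ n ∈ range N, ‖stirlingCoeff c z n‖ / (n + 1) ≤ C := by
  have hpos : 0 < c₀ := (Real.log_pos one_lt_two).trans hc₀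
  induction z using complex_induction_re with
  | neg z hz =>
    rw [← neg_neg z]
    exact exists_sum_norm_stirlingCoeff_neg_le hc₀ (by simpa using hz)
  | step z ih =>
    obtain ⟨C, hC⟩ := ih
    have : 0 ≤ C := hC c₀ le_rfl 0
    refine ⟨1 + ‖z‖ / c₀ * C, fun c hc N => ?_⟩
    refine (sum_le_sum_of_subset_of_nonneg (range_mono N.le_succ)
      fun n _ _ => by positivity).trans ?_
    refine (sum_norm_stirlingCoeff_le (hpos.trans_le hc) z N).trans ?_
    gcongr
    exact hC c hc N

theorem summable_norm_stirlingCoeff_div {c : ℝ} (hc : Real.log 2 < c) (z : ℂ) :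
    Summable fun n : ℕ => ‖stirlingCoeff c z n‖ / (n + 1) :=
  have ⟨_, hC⟩ := exists_sum_norm_stirlingCoeff_le hc z
  summable_of_sum_range_le (fun _ => by positivity) (hC c le_rfl)

theorem hasSum_stirlingCoeff_div {c : ℝ} (hc : Real.log 2 < c) (z : ℂ) :
    HasSum (fun n : ℕ => stirlingCoeff c z n / (n + 1))
      (c * Real.exp c * genExpIntegral c z) := by
  have hpos : 0 < c := (Real.log_pos one_lt_two).trans hc
  induction z using complex_induction_re with
  | neg z hz =>
    rw [← neg_neg z]
    exact hasSum_stirlingCoeff_neg_div hc (by simpa using hz)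
  | step z ih =>
    have hsummable : Summable fun n : ℕ => stirlingCoeff c z n / ((n : ℂ) + 1) :=
      (summable_norm_stirlingCoeff_div hc z).of_norm_bounded fun n => by
        rw [norm_div, norm_natCast_add_one]
    rw [hsummable.hasSum_iff_tendsto_nat, ← tendsto_add_atTop_iff_nat 1]
    simp only [sum_stirlingCoeff_div]
    have hlim := ((ih.tendsto_sum_nat.sub (tendsto_partialSum_div_of_summable
      (summable_norm_stirlingCoeff_div hc (z - 1)))).const_mul (z / (c : ℂ))).const_add 1
    have hc' : (c : ℂ) ≠ 0 := mod_cast hpos.ne'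
    have hexp : (Real.exp c : ℂ) * Real.exp (-c) = 1 := by
      rw [← Complex.ofReal_mul, ← Real.exp_add, add_neg_cancel, Real.exp_zero, Complex.ofReal_one]
    convert! hlim using 2
    rw [sub_zero, mul_right_comm, mul_genExpIntegral hpos]
    field_simp
    linear_combination hexp

end StirlingSeries

section StirlingSeriesTerm

/-- The term `1/(n+1)! ∑_{i=0}^n b_{i+1} [n,i] z (z - 1) ⋯ (z - i + 1)`. -/
noncomputable def stirlingTerm (b : ℕ → ℝ) (z : ℂ) (n : ℕ) : ℂ :=
  1 / ((n + 1).factorial : ℂ) * ∑ i ∈ range (n + 1),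
    (b (i + 1) : ℂ) * (Nat.stirlingFirst n i : ℂ) * (descPochhammer ℂ i).eval z

variable {ι : Type*} {l : ι → ℝ} {c₀ : ℝ} {b : ℕ → ℝ}

theorem summable_exp_neg_div_pow (hc₀ : 0 < c₀) (hl : ∀ m, c₀ ≤ l m)
    (hexp : Summable fun m => Real.exp (-l m)) (k : ℕ) :
    Summable fun m => Real.exp (-l m) / l m ^ k := by
  have hpos (m : ι) : 0 < l m := hc₀.trans_le (hl m)
  refine .of_nonneg_of_le (fun m => ?_) (fun m => ?_) (hexp.div_const (c₀ ^ k))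
  · have := hpos m
    positivity
  · gcongr
    exact hl m

theorem hasSum_exp_neg_mul_stirlingCoeff (hl : ∀ m, l m ≠ 0)
    (hb : ∀ k, 1 ≤ k → HasSum (fun m => Real.exp (-l m) / l m ^ k) (b k)) (z : ℂ) (n : ℕ) :
    HasSum (fun m => ((Real.exp (-l m) / l m : ℝ) : ℂ) * (stirlingCoeff (l m) z n / (n + 1)))
      (stirlingTerm b z n) := by
  have h := (hasSum_sum (s := range (n + 1)) fun i _ =>
    ((Complex.hasSum_ofReal.2 (hb (i + 1) i.succ_pos)).mul_right
      (Nat.stirlingFirst n i : ℂ)).mul_right ((descPochhammer ℂ i).eval z)).mul_left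
    (1 / ((n + 1).factorial : ℂ))
  convert! h using 1
  ext m
  have hlm : (l m : ℂ) ≠ 0 := mod_cast hl m
  rw [stirlingCoeff, Nat.factorial_succ, div_div, mul_div_assoc', mul_sum, one_div_mul_eq_div]
  push_cast
  rw [mul_comm (n.factorial : ℂ)]
  congr 1
  refine sum_congr rfl fun i _ => ?_
  rw [pow_succ]
  field_simp

theorem hasSum_exp_neg_mul_stirlingCoeff_genExpIntegral {c : ℝ} (hc : Real.log 2 < c) (z : ℂ) :
    HasSum (fun n : ℕ => ((Real.exp (-c) / c : ℝ) : ℂ) * (stirlingCoeff c z n / (n + 1)))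
      (genExpIntegral c z) := by
  have hc' : (c : ℂ) ≠ 0 := mod_cast ((Real.log_pos one_lt_two).trans hc).ne'
  have hexp : (Real.exp (-c) : ℂ) * Real.exp c = 1 := by
    rw [← Complex.ofReal_mul, ← Real.exp_add, neg_add_cancel, Real.exp_zero, Complex.ofReal_one]
  convert! (hasSum_stirlingCoeff_div hc z).mul_left ((Real.exp (-c) / c : ℝ) : ℂ) using 1
  rw [Complex.ofReal_div]
  field_simp
  linear_combination -genExpIntegral c z * hexp

theorem summable_norm_exp_neg_mul_stirlingCoeff (hc₀ : Real.log 2 < c₀) (hl : ∀ m, c₀ ≤ l m)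
    (hexp : Summable fun m => Real.exp (-l m) / l m) (z : ℂ) :
    Summable fun p : ι × ℕ =>
      ‖((Real.exp (-l p.1) / l p.1 : ℝ) : ℂ) * (stirlingCoeff (l p.1) z p.2 / (p.2 + 1))‖ := by
  obtain ⟨C, hC⟩ := exists_sum_norm_stirlingCoeff_le hc₀ z
  have hw (m : ι) : 0 ≤ Real.exp (-l m) / l m :=
    div_nonneg (Real.exp_nonneg _) (((Real.log_pos one_lt_two).trans hc₀).le.trans (hl m))
  rw [summable_prod_of_nonneg fun _ => norm_nonneg _]
  simp only [norm_mul, norm_div, norm_natCast_add_one, Complex.norm_real,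
    Real.norm_of_nonneg (hw _)]
  refine ⟨fun m => (summable_norm_stirlingCoeff_div (hc₀.trans_le (hl m)) z).mul_left _,
    .of_nonneg_of_le (fun m => tsum_nonneg fun n => mul_nonneg (hw m) (by positivity))
      (fun m => ?_) (hexp.mul_right C)⟩
  rw [tsum_mul_left]
  exact mul_le_mul_of_nonneg_left
    (Real.tsum_le_of_sum_range_le (fun n => by positivity) (hC (l m) (hl m))) (hw m)

theorem summable_norm_stirlingTerm (hc₀ : Real.log 2 < c₀) (hl : ∀ m, c₀ ≤ l m)
    (hb : ∀ k, 1 ≤ k → HasSum (fun m => Real.exp (-l m) / l m ^ k) (b k)) (z : ℂ) :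
    Summable fun n => ‖stirlingTerm b z n‖ := by
  have hexp : Summable fun m => Real.exp (-l m) / l m := by simpa using (hb 1 le_rfl).summable
  have hne (m : ι) : l m ≠ 0 := ((Real.log_pos one_lt_two).trans (hc₀.trans_le (hl m))).ne'
  have hswap := (Equiv.prodComm ℕ ι).summable_iff.2
    (summable_norm_exp_neg_mul_stirlingCoeff hc₀ hl hexp z)
  refine .of_nonneg_of_le (fun n => norm_nonneg _) (fun n => ?_) hswap.prod
  rw [← (hasSum_exp_neg_mul_stirlingCoeff hne hb z n).tsum_eq]
  exact norm_tsum_le_tsum_norm (hswap.prod_factor n)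

theorem hasSum_stirlingTerm (hc₀ : Real.log 2 < c₀) (hl : ∀ m, c₀ ≤ l m)
    (hb : ∀ k, 1 ≤ k → HasSum (fun m => Real.exp (-l m) / l m ^ k) (b k)) (z : ℂ) :
    HasSum (stirlingTerm b z) (∑' m, genExpIntegral (l m) z) := by
  have hexp : Summable fun m => Real.exp (-l m) / l m := by simpa using (hb 1 le_rfl).summable
  have hne (m : ι) : l m ≠ 0 := ((Real.log_pos one_lt_two).trans (hc₀.trans_le (hl m))).ne'
  have htotal := (summable_norm_exp_neg_mul_stirlingCoeff hc₀ hl hexp z).of_norm.hasSum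
  have hrows := htotal.prod_fiberwise fun m =>
    hasSum_exp_neg_mul_stirlingCoeff_genExpIntegral (hc₀.trans_le (hl m)) z
  rw [hrows.tsum_eq]
  exact ((Equiv.prodComm ℕ ι).hasSum_iff.2 htotal).prod_fiberwise fun n =>
    hasSum_exp_neg_mul_stirlingCoeff hne hb z n

theorem integral_norm_cpow_mul_exp_neg_le (hc₀ : 0 < c₀) {c : ℝ} (hc : c₀ ≤ c) (z : ℂ) :
    ∫ x in Set.Ioi (1 : ℝ), ‖(x : ℂ) ^ z * (Real.exp (-(c * x)) : ℂ)‖ ≤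
      Real.exp (-c) * (Real.exp c₀ *
        ∫ x in Set.Ioi (1 : ℝ), ‖(x : ℂ) ^ z * (Real.exp (-(c₀ * x)) : ℂ)‖) := by
  simp only [← integral_const_mul]
  refine setIntegral_mono_on (integrableOn_cpow_mul_exp_neg_Ioi_one z (hc₀.trans_le hc)).norm
    (((integrableOn_cpow_mul_exp_neg_Ioi_one z hc₀).norm.const_mul _).const_mul _)
    measurableSet_Ioi fun x (hx : 1 < x) => ?_
  rw [norm_cpow_mul_exp z (by linarith), norm_cpow_mul_exp z (by linarith), mul_left_comm _ (x ^ _),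
    mul_left_comm _ (x ^ _), ← Real.exp_add, ← Real.exp_add]
  gcongr
  nlinarith

theorem hasSum_genExpIntegral [Countable ι] (hc₀ : 0 < c₀) (hl : ∀ m, c₀ ≤ l m)
    (hexp : Summable fun m => Real.exp (-l m)) {g : ℝ → ℂ}
    (hg : ∀ x, 1 < x → HasSum (fun m => (Real.exp (-(l m * x)) : ℂ)) (g x)) (z : ℂ) :
    HasSum (fun m => genExpIntegral (l m) z) (∫ x in Set.Ioi (1 : ℝ), (x : ℂ) ^ z * g x) := by
  have h := hasSum_integral_of_summable_integral_norm
    (fun m => integrableOn_cpow_mul_exp_neg_Ioi_one z (hc₀.trans_le (hl m)))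
    (.of_nonneg_of_le (fun m => integral_nonneg fun x => norm_nonneg _)
      (fun m => integral_norm_cpow_mul_exp_neg_le hc₀ (hl m) z) (hexp.mul_right _))
  rwa [setIntegral_congr_fun measurableSet_Ioi fun x hx => ((hg x hx).mul_left _).tsum_eq] at h

end StirlingSeriesTerm

section MellinSplit

variable {E : Type*} [NormedAddCommGroup E] [NormedSpace ℂ E]

theorem mellin_indicator {f : ℝ → E} {u : Set ℝ} (hu : MeasurableSet u) (hu₀ : u ⊆ Set.Ioi 0)
    (s : ℂ) : mellin (u.indicator f) s = ∫ x in u, (x : ℂ) ^ (s - 1) • f x := by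
  have h := fun x : ℝ => (Set.indicator_smul_apply u (fun x : ℝ => (x : ℂ) ^ (s - 1)) f x).symm
  rw [mellin, integral_congr_ae (.of_forall h), setIntegral_indicator hu,
    Set.inter_eq_self_of_subset_right hu₀]

theorem setIntegral_Ioc_zero_one_cpow_smul (f : ℝ → E) (s : ℂ) :
    ∫ x in Set.Ioc (0 : ℝ) 1, (x : ℂ) ^ (s - 1) • f x =
      ∫ x in Set.Ioi (1 : ℝ), (x : ℂ) ^ (-s - 1) • f x⁻¹ := by
  have hinv {x : ℝ} (hx : 0 < x) :
      (Set.Ioc (0 : ℝ) 1).indicator f x⁻¹ = (Set.Ici (1 : ℝ)).indicator (fun x => f x⁻¹) x := by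
    have hmem : x⁻¹ ∈ Set.Ioc (0 : ℝ) 1 ↔ x ∈ Set.Ici 1 := by simp [inv_le_one₀ hx, hx]
    simp only [Set.indicator_apply, hmem]
  calc ∫ x in Set.Ioc (0 : ℝ) 1, (x : ℂ) ^ (s - 1) • f x
      = mellin ((Set.Ioc (0 : ℝ) 1).indicator f) s :=
        (mellin_indicator measurableSet_Ioc Set.Ioc_subset_Ioi_self s).symm
    _ = mellin (fun x => (Set.Ioc (0 : ℝ) 1).indicator f x⁻¹) (-s) := by
        rw [mellin_comp_inv, neg_neg]
    _ = mellin ((Set.Ici (1 : ℝ)).indicator fun x => f x⁻¹) (-s) :=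
        setIntegral_congr_fun measurableSet_Ioi fun x hx => by simp only [hinv hx]
    _ = ∫ x in Set.Ioi (1 : ℝ), (x : ℂ) ^ (-s - 1) • f x⁻¹ := by
        rw [mellin_indicator measurableSet_Ici (Set.Ici_subset_Ioi.2 one_pos),
          integral_Ici_eq_integral_Ioi]

theorem mellin_eq_integral_Ioi_one_add {f : ℝ → E} {s : ℂ} (hf : MellinConvergent f s) :
    mellin f s = (∫ x in Set.Ioi (1 : ℝ), (x : ℂ) ^ (s - 1) • f x) +
      ∫ x in Set.Ioi (1 : ℝ), (x : ℂ) ^ (-s - 1) • f x⁻¹ := by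
  rw [← setIntegral_Ioc_zero_one_cpow_smul, add_comm, mellin,
    ← Set.Ioc_union_Ioi_eq_Ioi zero_le_one,
    setIntegral_union (Set.Ioc_disjoint_Ioi le_rfl) measurableSet_Ioi
      (hf.mono_set Set.Ioc_subset_Ioi_self) (hf.mono_set (Set.Ioi_subset_Ioi zero_le_one))]

end MellinSplit

section Theta

/-- The exponents `π n²` of the theta series, counted from `n = 1`. -/
noncomputable def piSq (m : ℕ) : ℝ :=
  Real.pi * (m + 1) ^ 2

theorem pi_le_piSq (m : ℕ) : Real.pi ≤ piSq m :=
  le_mul_of_one_le_right Real.pi_pos.le (one_le_pow₀ (by simp))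

theorem hasSum_exp_neg_piSq_mul {x : ℝ} (hx : 0 < x) :
    HasSum (fun m => Real.exp (-(piSq m * x))) ((HurwitzZeta.evenKernel 0 x - 1) / 2) := by
  have h := (HurwitzZeta.hasSum_nat_cosKernel₀ 0 hx).div_const 2
  rw [HurwitzZeta.evenKernel_eq_cosKernel_of_zero]
  convert! h using 1
  · ext m
    rw [mul_zero, zero_mul, Real.cos_zero, piSq]
    ring_nf

theorem summable_bTerm (k : ℕ) : Summable (bTerm k) :=
  summable_exp_neg_div_pow Real.pi_pos pi_le_piSq
    (by simpa using (hasSum_exp_neg_piSq_mul one_pos).summable) k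

theorem log_two_lt_pi : Real.log 2 < Real.pi := by
  linarith [Real.log_two_lt_d9, Real.pi_gt_three]

theorem hurwitzEvenFEPair_zero_f_modif {x : ℝ} (hx : 1 < x) :
    (HurwitzZeta.hurwitzEvenFEPair 0).f_modif x = (HurwitzZeta.evenKernel 0 x - 1 : ℝ) := by
  simp [WeakFEPair.f_modif, hx, hx.le, HurwitzZeta.hurwitzEvenFEPair]

theorem hurwitzEvenFEPair_zero_f_modif_inv {x : ℝ} (hx : 1 < x) :
    (HurwitzZeta.hurwitzEvenFEPair 0).f_modif x⁻¹ =
      (x : ℂ) ^ (1 / 2 : ℂ) * (HurwitzZeta.hurwitzEvenFEPair 0).f_modif x := by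
  let P := HurwitzZeta.hurwitzEvenFEPair 0
  have hsymm : P.g_modif = P.f_modif :=
    congrArg WeakFEPair.f_modif HurwitzZeta.hurwitzEvenFEPair_zero_symm
  have h := P.hf_modif_FE x (zero_lt_one.trans hx)
  rw [hsymm, one_div] at h
  rw [h]
  simp [P, HurwitzZeta.hurwitzEvenFEPair, Complex.ofReal_cpow (zero_lt_one.trans hx).le]

theorem completedRiemannZeta₀_eq_integral (s : ℂ) :
    completedRiemannZeta₀ s =
      (∫ x in Set.Ioi (1 : ℝ), (x : ℂ) ^ (s / 2 - 1) *
        (((HurwitzZeta.evenKernel 0 x - 1) / 2 : ℝ) : ℂ)) +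
      ∫ x in Set.Ioi (1 : ℝ), (x : ℂ) ^ ((1 - s) / 2 - 1) *
        (((HurwitzZeta.evenKernel 0 x - 1) / 2 : ℝ) : ℂ) := by
  let P := HurwitzZeta.hurwitzEvenFEPair 0
  have hconv : MellinConvergent P.f_modif (s / 2) :=
    (P.isStrongFEPair_toStrongFEPair.hasMellin (s / 2)).1
  calc completedRiemannZeta₀ s = mellin P.f_modif (s / 2) / 2 := rfl
    _ = _ := by
      rw [mellin_eq_integral_Ioi_one_add hconv, add_div, ← integral_div, ← integral_div]
      congr 1
      · refine setIntegral_congr_fun measurableSet_Ioi fun x hx => ?_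
        simp only [P, hurwitzEvenFEPair_zero_f_modif hx, smul_eq_mul]
        push_cast
        ring
      · refine setIntegral_congr_fun measurableSet_Ioi fun x (hx : 1 < x) => ?_
        have hx0 : (x : ℂ) ≠ 0 := mod_cast (zero_lt_one.trans hx).ne'
        simp only [P, hurwitzEvenFEPair_zero_f_modif_inv hx, hurwitzEvenFEPair_zero_f_modif hx,
          smul_eq_mul]
        rw [show (1 - s) / 2 - 1 = (-(s / 2) - 1) + 1 / 2 by ring, Complex.cpow_add _ _ hx0]
        push_cast
        ring

theorem completedRiemannZeta₀_eq_tsum_genExpIntegral (s : ℂ) :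
    completedRiemannZeta₀ s =
      (∑' m, genExpIntegral (piSq m) (s / 2 - 1)) +
        ∑' m, genExpIntegral (piSq m) ((1 - s) / 2 - 1) := by
  have hexp : Summable fun m => Real.exp (-piSq m) := by
    simpa using (hasSum_exp_neg_piSq_mul one_pos).summable
  have hsum := hasSum_genExpIntegral Real.pi_pos pi_le_piSq hexp fun x hx =>
    Complex.hasSum_ofReal.2 (hasSum_exp_neg_piSq_mul (zero_lt_one.trans hx))
  rw [completedRiemannZeta₀_eq_integral, (hsum _).tsum_eq, (hsum _).tsum_eq]

end Theta

section XiSeries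

/-- The common term of the two series: the Stirling terms for `π^{-s/2} Γ(s/2) ζ(s)` at `s` and at
its reflection `1 - s`, including the index `i = 0`. -/
noncomputable def symmTerm (s : ℂ) (n : ℕ) : ℂ :=
  stirlingTerm bConst ((1 - s) / 2 - 1) n + stirlingTerm bConst (s / 2 - 1) n

theorem hasSum_bConst (k : ℕ) :
    HasSum (fun m => Real.exp (-piSq m) / piSq m ^ k) (bConst k) :=
  (summable_bTerm k).hasSum

theorem summable_norm_symmTerm (s : ℂ) : Summable fun n => ‖symmTerm s n‖ :=
  have h := summable_norm_stirlingTerm log_two_lt_pi pi_le_piSq fun k _ => hasSum_bConst k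
  .of_nonneg_of_le (fun _ => norm_nonneg _) (fun _ => norm_add_le _ _) ((h _).add (h _))

theorem hasSum_symmTerm (s : ℂ) : HasSum (symmTerm s) (completedRiemannZeta₀ s) := by
  have h := hasSum_stirlingTerm log_two_lt_pi pi_le_piSq fun k _ => hasSum_bConst k
  rw [completedRiemannZeta₀_eq_tsum_genExpIntegral, add_comm]
  exact (h _).add (h _)

theorem symmTerm_zero (s : ℂ) : symmTerm s 0 = 2 * (bConst 1 : ℂ) := by
  simp [symmTerm, stirlingTerm, two_mul]

theorem prod_Icc_one_sub {R : Type*} [CommRing R] (a : R) (i : ℕ) :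
    ∏ j ∈ Icc 1 i, (a - (j : R)) = (descPochhammer R i).eval (a - 1) := by
  rw [descPochhammer_eval_eq_prod_range, ← Ico_succ_right_eq_Icc, prod_Ico_eq_prod_range]
  refine prod_congr (by simp) fun j _ => ?_
  push_cast
  ring

theorem prod_range_succ_sub {R : Type*} [CommRing R] (a : R) (i : ℕ) :
    ∏ j ∈ range (i + 1), (a - (j : R)) = a * (descPochhammer R i).eval (a - 1) := by
  rw [← descPochhammer_eval_eq_prod_range, descPochhammer_succ_left]
  simp

theorem zetaTerm_succ (s : ℂ) (n : ℕ) : zetaTerm s (n + 1) = symmTerm s (n + 1) := by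
  rw [zetaTerm, symmTerm, stirlingTerm, stirlingTerm, ← mul_add, ← sum_add_distrib, range_eq_Ico,
    sum_eq_sum_Ico_succ_bot (n + 1).succ_pos, Nat.stirlingFirst_succ_zero, zero_add,
    Nat.succ_eq_add_one, Ico_add_one_right_eq_Icc]
  simp [prod_Icc_one_sub, mul_add]

theorem xiTerm_eq (s : ℂ) (n : ℕ) : xiTerm s n = s * (1 - s) / 2 * symmTerm s n := by
  rw [xiTerm, symmTerm, stirlingTerm, stirlingTerm, ← mul_add, ← sum_add_distrib,
    mul_left_comm, mul_sum _ _ (s * (1 - s) / 2)]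
  congr 1
  refine sum_congr rfl fun i _ => ?_
  rw [prod_range_succ_sub, prod_range_succ_sub]
  ring

theorem isRegularPoint_iff {s : ℂ} : IsRegularPoint s ↔ s ≠ 1 ∧ Complex.Gammaℝ s ≠ 0 := by
  simp [IsRegularPoint, Complex.Gammaℝ_eq_zero_iff]

theorem IsRegularPoint.ne_zero {s : ℂ} (hs : IsRegularPoint s) : s ≠ 0 := by
  simpa using hs.2 0

theorem piGammaZeta_eq {s : ℂ} (hs : IsRegularPoint s) :
    piGammaZeta s = completedRiemannZeta s := by
  rw [piGammaZeta, riemannZeta_def_of_ne_zero hs.ne_zero, ← Complex.Gammaℝ_def,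
    mul_div_cancel₀ _ (isRegularPoint_iff.1 hs).2]

theorem eventually_isRegularPoint (s : ℂ) : ∀ᶠ z in 𝓝[≠] s, IsRegularPoint z := by
  have hanalytic : AnalyticOnNhd ℂ (fun z => (Complex.Gammaℝ z)⁻¹) Set.univ :=
    Complex.differentiable_Gammaℝ_inv.differentiableOn.analyticOnNhd isOpen_univ
  have hgamma : ∀ᶠ z in 𝓝[≠] s, (Complex.Gammaℝ z)⁻¹ ≠ 0 := by
    refine (hanalytic s trivial).eventually_eq_zero_or_eventually_ne_zero.resolve_left fun h => ?_
    have h := hanalytic.eqOn_zero_of_preconnected_of_eventuallyEq_zero isPreconnected_univ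
      (Set.mem_univ s) h (Set.mem_univ 1)
    simp [Complex.Gammaℝ_one] at h
  have hne : ∀ᶠ z in 𝓝[≠] s, z ≠ 1 := by
    rcases eq_or_ne s 1 with rfl | hs
    · exact self_mem_nhdsWithin
    · exact nhdsWithin_le_nhds (eventually_ne_nhds hs)
  filter_upwards [hgamma, hne] with z hz h1
  exact isRegularPoint_iff.2 ⟨h1, ne_of_apply_ne Inv.inv (by rwa [inv_zero])⟩

theorem neg_mul_completedRiemannZeta {s : ℂ} (h0 : s ≠ 0) (h1 : s ≠ 1) :
    -(s * (1 - s) / 2) * completedRiemannZeta s =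
      (1 - s * (1 - s) * completedRiemannZeta₀ s) / 2 := by
  have h1' : 1 - s ≠ 0 := sub_ne_zero.2 h1.symm
  rw [completedRiemannZeta_eq]
  field_simp
  ring

theorem riemannXi_eq (s : ℂ) :
    riemannXi s = (1 - s * (1 - s) * completedRiemannZeta₀ s) / 2 := by
  have hcont : Continuous fun z : ℂ => (1 - z * (1 - z) * completedRiemannZeta₀ z) / 2 := by
    have := differentiable_completedZeta₀.continuous
    fun_prop
  refine Tendsto.limUnder_eq (((hcont.tendsto s).mono_left nhdsWithin_le_nhds).congr' ?_)
  filter_upwards [eventually_isRegularPoint s] with z hz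
  rw [piGammaZeta_eq hz, neg_mul_completedRiemannZeta hz.ne_zero hz.1]

theorem differentiable_riemannXi : Differentiable ℂ riemannXi := by
  have := differentiable_completedZeta₀
  rw [funext riemannXi_eq]
  fun_prop

theorem riemannXi_eq_of_isRegularPoint {s : ℂ} (hs : IsRegularPoint s) :
    riemannXi s = -(s * (1 - s) / 2) * piGammaZeta s := by
  rw [riemannXi_eq, piGammaZeta_eq hs, neg_mul_completedRiemannZeta hs.ne_zero hs.1]

theorem two_mul_riemannXi_eq (s : ℂ) : 2 * riemannXi s = 1 - 2 * ∑' n : ℕ, xiTerm s n := by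
  simp only [xiTerm_eq]
  rw [tsum_mul_left, (hasSum_symmTerm s).tsum_eq, riemannXi_eq]
  ring

theorem summable_norm_xiTerm (s : ℂ) : Summable fun n => ‖xiTerm s n‖ := by
  simp only [xiTerm_eq, norm_mul]
  exact (summable_norm_symmTerm s).mul_left _

theorem summable_norm_zetaTerm_succ (s : ℂ) : Summable fun n => ‖zetaTerm s (n + 1)‖ := by
  simp only [zetaTerm_succ]
  exact (summable_nat_add_iff 1).2 (summable_norm_symmTerm s)

theorem completedRiemannZeta_eq_tsum_zetaTerm (s : ℂ) :
    completedRiemannZeta s =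
      2 * (bConst 1 : ℂ) + ∑' n : ℕ, zetaTerm s (n + 1) - (1 / (1 - s) + 1 / s) := by
  have h := (hasSum_symmTerm s).summable.tsum_eq_zero_add
  rw [(hasSum_symmTerm s).tsum_eq, symmTerm_zero] at h
  simp only [zetaTerm_succ]
  rw [← h, completedRiemannZeta_eq]
  ring

theorem tendsto_piGammaZeta {s : ℂ} (h0 : s ≠ 0) (h1 : s ≠ 1) :
    Tendsto piGammaZeta (𝓝[≠] s) (𝓝 (completedRiemannZeta s)) := by
  refine ((differentiableAt_completedZeta h0 h1).continuousAt.tendsto.mono_left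
    nhdsWithin_le_nhds).congr' ?_
  filter_upwards [eventually_isRegularPoint s] with z hz
  exact (piGammaZeta_eq hz).symm

end XiSeries

theorem mainTheorem3 :
    -- the series defining the constants `b_k` converge
    (∀ k : ℕ, 1 ≤ k → Summable (bTerm k)) ∧
    -- `ξ` is entire and has the defining expression wherever that is meaningful
    Differentiable ℂ riemannXi ∧
    (∀ s : ℂ, IsRegularPoint s → riemannXi s = -(s * (1 - s) / 2) * piGammaZeta s) ∧
    -- the series for `ξ`, at every `s`
    (∀ s : ℂ, Summable (fun n : ℕ => ‖xiTerm s n‖) ∧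
      2 * riemannXi s = 1 - 2 * ∑' n : ℕ, xiTerm s n) ∧
    (∀ s : ℂ, IsRegularPoint s →
      -s * (1 - s) * piGammaZeta s = 1 - 2 * ∑' n : ℕ, xiTerm s n) ∧
    -- the series for `π^{-s/2} Γ(s/2) ζ(s)`; the sum runs over `n ≥ 1`
    (∀ s : ℂ, Summable (fun n : ℕ => ‖zetaTerm s (n + 1)‖)) ∧
    (∀ s : ℂ, IsRegularPoint s →
      piGammaZeta s =
        2 * (bConst 1 : ℂ) + ∑' n : ℕ, zetaTerm s (n + 1) - (1 / (1 - s) + 1 / s)) ∧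
    -- at the removable singularities `-2, -4, …` it gives the limit
    (∀ s : ℂ, s ≠ 0 → s ≠ 1 →
      Tendsto piGammaZeta (𝓝[≠] s)
        (𝓝 (2 * (bConst 1 : ℂ) + ∑' n : ℕ, zetaTerm s (n + 1) - (1 / (1 - s) + 1 / s)))) := by
  refine ⟨fun k _ => summable_bTerm k, differentiable_riemannXi,
    fun s => riemannXi_eq_of_isRegularPoint,
    fun s => ⟨summable_norm_xiTerm s, two_mul_riemannXi_eq s⟩, fun s hs => ?_,
    summable_norm_zetaTerm_succ, fun s hs => ?_, fun s h0 h1 => ?_⟩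
  · rw [← two_mul_riemannXi_eq, riemannXi_eq_of_isRegularPoint hs]
    ring
  · rw [piGammaZeta_eq hs, completedRiemannZeta_eq_tsum_zetaTerm]
  · rw [← completedRiemannZeta_eq_tsum_zetaTerm]
    exact tendsto_piGammaZeta h0 h1
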